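/- Let $(\mathbb M,g)$ be a complete, connected, smooth Riemannian manifold of dimension $n$ without boundary, with Laplace-Beltrami operator $\Delta_g f=\frac{1}{\sqrt{|g|}}\,\partial_i\big(\sqrt{|g|}\,g^{ij}\partial_j f\big)$ (in local coordinates, summed over $i,j$), Riemannian gradient $\nabla_g$ and volume element $dV_g$. Let $H_i\in C^1(\mathbb R^m)$ for $1\le i\le m$, and let $u=(u_i)_{i=1}^m$ with $u_i\in C^3(\mathbb M)$ be a solution of $$-\Delta_g u_i=H_i(u)\quad\text{on }\mathbb M,\qquad 1\le i\le m .$$ Write $\partial_jH_i(u)=\frac{\partial H_i}{\partial u_j}(u)$. Suppose that $u$ is stable, that is, there exist a constant $\lambda\ge 0$ and functions $\zeta_i\in C^3(\mathbb M)$, $1\le i\le m$, none of which changes sign, such that on $\mathbb M$ $$-\Delta_g\zeta_i=\sum_{j=1}^m\partial_jH_i(u)\,\zeta_j+\lambda\zeta_i\quad\text{for all }1\le i\le m,\qquad \partial_jH_i(u)\,\zeta_i\zeta_j>0\quad\text{for all }1\le i,j\le m .$$ Then for all compactly supported functions $\phi_1,\dots,\phi_m\in C^1_c(\mathbb M)$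 the integrals below are those of integrable functions, and $$\sum_{i,j=1}^m\int_{\mathbb M}\sqrt{\partial_jH_i(u)\,\partial_iH_j(u)}\;\phi_i\phi_j\,dV_g\;\le\;\sum_{i=1}^m\int_{\mathbb M}|\nabla_g\phi_i|^2\,dV_g .$$ -/

import Mathlib

open MeasureTheory Manifold Bundle
open scoped ContDiff

noncomputable section

namespace RiemannianSystem

section Geometry

variable {n : ℕ} {M : Type*} [TopologicalSpace M] [ChartedSpace (EuclideanSpace ℝ (Fin n)) M]
  [RiemannianBundle (fun x : M ↦ TangentSpace (𝓡 n) x)]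

/-- The matrix `g_{ij} = ⟨∂_i, ∂_j⟩_g` of the metric in the chart at `x`, as a function of the
coordinates `y`; here `∂_i` is the image of the `i`-th standard basis vector of `ℝⁿ` under the
differential of the inverse of the chart. It is meaningful for `y` in the target of the chart. -/
def metricMatrix (x : M) (y : EuclideanSpace ℝ (Fin n)) : Matrix (Fin n) (Fin n) ℝ :=
  Matrix.of fun i j ↦
    inner ℝ
      (mfderiv (𝓡 n) (𝓡 n) (chartAt (EuclideanSpace ℝ (Fin n)) x).symm y
        (EuclideanSpace.single i (1 : ℝ)))
      (mfderiv (𝓡 n) (𝓡 n) (chartAt (EuclideanSpace ℝ (Fin n)) x).symm y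
        (EuclideanSpace.single j (1 : ℝ)))

/-- The density `√|g|`, `|g| = det (g_{ij})`, in the chart at `x`. -/
def volumeDensity (x : M) (y : EuclideanSpace ℝ (Fin n)) : ℝ :=
  Real.sqrt (metricMatrix x y).det

/-- The `i`-th partial derivative of a function on `ℝⁿ`. -/
def coordDeriv (i : Fin n) (F : EuclideanSpace ℝ (Fin n) → ℝ) (y : EuclideanSpace ℝ (Fin n)) : ℝ :=
  fderiv ℝ F y (EuclideanSpace.single i (1 : ℝ))

/-- The Laplace-Beltrami operator
`Δ_g f = (1 / √|g|) ∑_{i,j} ∂_i (√|g| g^{ij} ∂_j f)`, computed at `p` in the chart at `p`. -/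
def laplaceBeltrami (f : M → ℝ) (p : M) : ℝ :=
  (volumeDensity p (chartAt (EuclideanSpace ℝ (Fin n)) p p))⁻¹ *
    ∑ i : Fin n, ∑ j : Fin n,
      coordDeriv i
        (fun y ↦ volumeDensity p y * (metricMatrix p y)⁻¹ i j *
          coordDeriv j (f ∘ (chartAt (EuclideanSpace ℝ (Fin n)) p).symm) y)
        (chartAt (EuclideanSpace ℝ (Fin n)) p p)

/-- The Riemannian gradient: the tangent vector `∇_g f (p)` with
`⟨∇_g f (p), v⟩_g = df_p (v)` for all tangent vectors `v` at `p`. -/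
def riemannianGradient (f : M → ℝ) (p : M) : TangentSpace (𝓡 n) p :=
  haveI : FiniteDimensional ℝ (TangentSpace (𝓡 n) p) :=
    inferInstanceAs (FiniteDimensional ℝ (EuclideanSpace ℝ (Fin n)))
  haveI : CompleteSpace (TangentSpace (𝓡 n) p) := FiniteDimensional.complete ℝ _
  (InnerProductSpace.toDual ℝ (TangentSpace (𝓡 n) p)).symm (mfderiv (𝓡 n) 𝓘(ℝ, ℝ) f p)

/-- The measure `√|g| dy¹ ⋯ dyⁿ` of the chart at `x`, carried by the source of that chart. -/
def chartVolume [MeasurableSpace M] (x : M) : Measure M :=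
  ((volume.restrict (chartAt (EuclideanSpace ℝ (Fin n)) x).target).withDensity
    (fun y ↦ ENNReal.ofReal (volumeDensity x y))).map
      (chartAt (EuclideanSpace ℝ (Fin n)) x).symm

end Geometry

section Volume

variable (n : ℕ) (M : Type*) [TopologicalSpace M] [ChartedSpace (EuclideanSpace ℝ (Fin n)) M]
  [SecondCountableTopology M] [Nonempty M]

theorem exists_chartSeq :
    ∃ c : ℕ → M, (⋃ k, (chartAt (EuclideanSpace ℝ (Fin n)) (c k)).source) = Set.univ := by
  obtain ⟨s, hs, hs'⟩ := TopologicalSpace.countable_cover_nhds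
    (fun x : M ↦ chart_source_mem_nhds (EuclideanSpace ℝ (Fin n)) x)
  have hne : s.Nonempty := by
    by_contra h
    rw [Set.not_nonempty_iff_eq_empty] at h
    subst h
    simp only [Set.biUnion_empty] at hs'
    exact Set.empty_ne_univ hs'
  obtain ⟨c, rfl⟩ := hs.exists_eq_range hne
  exact ⟨c, by simpa using hs'⟩

/-- A sequence of points whose preferred charts cover the manifold. -/
def chartSeq : ℕ → M := (exists_chartSeq n M).choose

/-- The Riemannian volume measure `dV_g`. The manifold is cut into countably many disjoint Borel
pieces, the `k`-th one being contained in the source of the `k`-th chart of a covering sequence, and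
on the `k`-th piece the measure is `√|g| dy¹ ⋯ dyⁿ` in the `k`-th chart. By the change of variables
formula the measures of two charts agree on the overlap, so the choices do not matter. -/
def riemannianVolume [RiemannianBundle (fun x : M ↦ TangentSpace (𝓡 n) x)] [MeasurableSpace M] :
    Measure M :=
  Measure.sum fun k ↦
    (chartVolume (n := n) (chartSeq n M k)).restrict
      (disjointed (fun l ↦ (chartAt (EuclideanSpace ℝ (Fin n)) (chartSeq n M l)).source) k)

end Volume

section System

variable {n m : ℕ} {M : Type*} [TopologicalSpace M] [ChartedSpace (EuclideanSpace ℝ (Fin n)) M]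
  [RiemannianBundle (fun x : M ↦ TangentSpace (𝓡 n) x)]

/-- `partialH H i j v` is `∂_j H_i (v)`. -/
def partialH (H : Fin m → (Fin m → ℝ) → ℝ) (i j : Fin m) (v : Fin m → ℝ) : ℝ :=
  fderiv ℝ (H i) v (Pi.single j (1 : ℝ))

/-- `u = (u_1, …, u_m)` is a `C³` solution of `-Δ_g u_i = H_i (u)` on `M`. -/
structure IsSolution (n : ℕ) {m : ℕ} {M : Type*} [TopologicalSpace M]
    [ChartedSpace (EuclideanSpace ℝ (Fin n)) M]
    [RiemannianBundle (fun x : M ↦ TangentSpace (𝓡 n) x)]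
    (H : Fin m → (Fin m → ℝ) → ℝ) (u : Fin m → M → ℝ) : Prop where
  contMDiff : ∀ i, ContMDiff (𝓡 n) 𝓘(ℝ, ℝ) 3 (u i)
  equation : ∀ i p, -laplaceBeltrami (n := n) (u i) p = H i (fun k ↦ u k p)

/-- `u` is a stable solution of `-Δ_g u_i = H_i (u)` on `M`: it is a solution, and the linearized
system `-Δ_g ζ_i = ∑_j ∂_j H_i (u) ζ_j + λ ζ_i` holds for some constant `λ ≥ 0` and some `C³`
functions `ζ_i`, none of which changes sign, with `∂_j H_i (u) ζ_i ζ_j > 0` for all `i, j`. -/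
structure IsStableSolution (n : ℕ) {m : ℕ} {M : Type*} [TopologicalSpace M]
    [ChartedSpace (EuclideanSpace ℝ (Fin n)) M]
    [RiemannianBundle (fun x : M ↦ TangentSpace (𝓡 n) x)]
    (H : Fin m → (Fin m → ℝ) → ℝ) (u : Fin m → M → ℝ) : Prop
    extends IsSolution n H u where
  stable : ∃ (ζ : Fin m → M → ℝ) (lam : ℝ), 0 ≤ lam ∧
    (∀ i, ContMDiff (𝓡 n) 𝓘(ℝ, ℝ) 3 (ζ i)) ∧
    (∀ i, (∀ p, 0 ≤ ζ i p) ∨ (∀ p, ζ i p ≤ 0)) ∧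
    (∀ i p, -laplaceBeltrami (n := n) (ζ i) p =
      (∑ j, partialH H i j (fun k ↦ u k p) * ζ j p) + lam * ζ i p) ∧
    (∀ i j p, 0 < partialH H i j (fun k ↦ u k p) * ζ i p * ζ j p)

end System

end RiemannianSystem

end

/-! Since `∂_jH_i(u) ζ_i ζ_i > 0` for `j = i`, no `ζ_i` vanishes, so the `i`-th linearized equation
can be tested with `φ_i² / ζ_i`. Writing `φ_i = χ_i ζ_i`, the difference `|∇φ_i|² - ⟨∇(φ_i²/ζ_i),
∇ζ_i⟩` equals `ζ_i² |∇χ_i|² ≥ 0` (`gradInner_mul_mul_le`), and Green's formula gives `∫ (∑_j B_ij +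
λ) φ_i² ≤ ∫ |∇φ_i|²` with `B_ij = ∂_jH_i(u) ζ_j / ζ_i > 0`. The quotients cancel in `B_ij B_ji =
∂_jH_i(u) ∂_iH_j(u)`, so after summing over `i` the inequality of arithmetic and geometric means
bounds the form with coefficients `√(B_ij B_ji)` by `∑ B_ij φ_i²` (`sum_sqrt_mul_le`), and `λ ≥ 0`
is discarded.

Most of the work is Green's formula, `integral_mul_laplaceBeltrami`, because `laplaceBeltrami` is
computed at each point in the chart of that point. In one fixed chart the formula is integration by
parts in `ℝⁿ`; its right side involves only the gradient and the volume, which are intrinsic. Hence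
the Laplacians of two charts have the same integrals against test functions supported in the
overlap, and being continuous they coincide there. A partition of unity then globalizes the formula.
-/

noncomputable section

namespace RiemannianSystem

/-! ### The metric in coordinates and its behaviour under a change of chart. -/

section PointwiseGeometry

variable {n : ℕ} {M : Type*} [TopologicalSpace M] [ChartedSpace (EuclideanSpace ℝ (Fin n)) M]

/-- The differential of the inverse of the chart at `x`, as an endomorphism of `ℝⁿ`. -/
def chartFrame (x : M) (y : EuclideanSpace ℝ (Fin n)) :
    EuclideanSpace ℝ (Fin n) →L[ℝ] EuclideanSpace ℝ (Fin n) :=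
  mfderiv (𝓡 n) (𝓡 n) (chartAt (EuclideanSpace ℝ (Fin n)) x).symm y

section

variable [RiemannianBundle (fun x : M ↦ TangentSpace (𝓡 n) x)]

/-- The inner product of the tangent space at `q`, as a bilinear form on `ℝⁿ`. -/
def tangentForm (q : M) : LinearMap.BilinForm ℝ (EuclideanSpace ℝ (Fin n)) :=
  LinearMap.mk₂ ℝ (fun v w ↦ inner ℝ (show TangentSpace (𝓡 n) q from v) w)
    (fun u v w ↦ inner_add_left (𝕜 := ℝ) (E := TangentSpace (𝓡 n) q) u v w)
    (fun c v w ↦ real_inner_smul_left (F := TangentSpace (𝓡 n) q) v w c)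
    (fun u v w ↦ inner_add_right (𝕜 := ℝ) (E := TangentSpace (𝓡 n) q) u v w)
    (fun c v w ↦ real_inner_smul_right (F := TangentSpace (𝓡 n) q) v w c)

theorem tangentForm_comm (q : M) (v w : EuclideanSpace ℝ (Fin n)) :
    tangentForm q v w = tangentForm q w v :=
  real_inner_comm (F := TangentSpace (𝓡 n) q) w v

theorem tangentForm_self_pos (q : M) {v : EuclideanSpace ℝ (Fin n)} (hv : v ≠ 0) :
    0 < tangentForm q v v :=
  real_inner_self_pos (F := TangentSpace (𝓡 n) q).2 hv

theorem metricMatrix_apply (x : M) (y : EuclideanSpace ℝ (Fin n)) (i j : Fin n) :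
    metricMatrix x y i j =
      tangentForm ((chartAt (EuclideanSpace ℝ (Fin n)) x).symm y)
        (chartFrame x y (EuclideanSpace.single i 1)) (chartFrame x y (EuclideanSpace.single j 1)) :=
  rfl

theorem tangentForm_chartFrame (x : M) (y v w : EuclideanSpace ℝ (Fin n)) :
    tangentForm ((chartAt (EuclideanSpace ℝ (Fin n)) x).symm y) (chartFrame x y v)
      (chartFrame x y w) = ∑ i, ∑ j, v i * metricMatrix x y i j * w j := by
  have hs (v : EuclideanSpace ℝ (Fin n)) : v = ∑ i, v i • EuclideanSpace.single i (1 : ℝ) := by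
    simpa using ((EuclideanSpace.basisFun (Fin n) ℝ).sum_repr v).symm
  conv_lhs => rw [hs v, hs w]
  simp only [map_sum, map_smul, LinearMap.sum_apply, LinearMap.smul_apply, smul_eq_mul,
    metricMatrix_apply, Finset.mul_sum]
  rw [Finset.sum_comm]
  refine Finset.sum_congr rfl fun i _ ↦ Finset.sum_congr rfl fun j _ ↦ by ring

theorem tangentForm_chartFrame' (x : M) (y v w : EuclideanSpace ℝ (Fin n)) :
    tangentForm ((chartAt (EuclideanSpace ℝ (Fin n)) x).symm y) (chartFrame x y v)
      (chartFrame x y w) = v.ofLp ⬝ᵥ (metricMatrix x y).mulVec w.ofLp := by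
  rw [tangentForm_chartFrame]
  simp only [dotProduct, Matrix.mulVec, Finset.mul_sum, mul_assoc]

theorem metricMatrix_isHermitian (x : M) (y : EuclideanSpace ℝ (Fin n)) :
    (metricMatrix x y).IsHermitian := by
  ext i j
  simp only [Matrix.conjTranspose_apply, metricMatrix_apply, star_trivial]
  exact tangentForm_comm _ _ _

/-- The Riemannian inner product of two gradients. -/
def gradInner (f h : M → ℝ) (q : M) : ℝ :=
  inner ℝ (riemannianGradient (n := n) f q) (riemannianGradient (n := n) h q)

/-- The Riemannian gradient, as a vector of `ℝⁿ`. -/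
def gradVector (f : M → ℝ) (q : M) : EuclideanSpace ℝ (Fin n) :=
  riemannianGradient (n := n) f q

theorem tangentForm_gradVector (f : M → ℝ) (q : M) (v : EuclideanSpace ℝ (Fin n)) :
    tangentForm q (gradVector f q) v = mfderiv (𝓡 n) 𝓘(ℝ, ℝ) f q v := by
  have : FiniteDimensional ℝ (TangentSpace (𝓡 n) q) :=
    inferInstanceAs (FiniteDimensional ℝ (EuclideanSpace ℝ (Fin n)))
  have : CompleteSpace (TangentSpace (𝓡 n) q) := FiniteDimensional.complete ℝ _
  exact InnerProductSpace.toDual_symm_apply (𝕜 := ℝ) (E := TangentSpace (𝓡 n) q)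

theorem gradInner_self (f : M → ℝ) (q : M) :
    gradInner (n := n) f f q = ‖riemannianGradient (n := n) f q‖ ^ 2 :=
  real_inner_self_eq_norm_sq _

end

variable [IsManifold (𝓡 n) ∞ M]

theorem mdifferentiableAt_chart_symm {x : M} {y : EuclideanSpace ℝ (Fin n)}
    (hy : y ∈ (chartAt (EuclideanSpace ℝ (Fin n)) x).target) :
    MDifferentiableAt (𝓡 n) (𝓡 n) (chartAt (EuclideanSpace ℝ (Fin n)) x).symm y :=
  mdifferentiableAt_atlas_symm (chart_mem_atlas _ x) hy

theorem chartFrame_injective {x : M} {y : EuclideanSpace ℝ (Fin n)}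
    (hy : y ∈ (chartAt (EuclideanSpace ℝ (Fin n)) x).target) :
    Function.Injective (chartFrame x y) := by
  have h := mdifferentiable_chart (I := 𝓡 n) x
  exact (h.symm.mfderiv_injective (x := y) hy)

theorem chartFrame_surjective {x : M} {y : EuclideanSpace ℝ (Fin n)}
    (hy : y ∈ (chartAt (EuclideanSpace ℝ (Fin n)) x).target) :
    Function.Surjective (chartFrame x y) :=
  (LinearMap.injective_iff_surjective (f := (chartFrame x y).toLinearMap)).1
    (chartFrame_injective hy)

/-- The coordinate change from the chart at `x` to the chart at `p`. -/
def transition (x p : M) (y : EuclideanSpace ℝ (Fin n)) : EuclideanSpace ℝ (Fin n) :=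
  chartAt (EuclideanSpace ℝ (Fin n)) p ((chartAt (EuclideanSpace ℝ (Fin n)) x).symm y)

theorem transition_differentiableAt {x p : M} {y : EuclideanSpace ℝ (Fin n)}
    (hy : y ∈ (chartAt (EuclideanSpace ℝ (Fin n)) x).target)
    (hp : (chartAt (EuclideanSpace ℝ (Fin n)) x).symm y ∈
      (chartAt (EuclideanSpace ℝ (Fin n)) p).source) :
    DifferentiableAt ℝ (transition x p) y := by
  have h2 := (mdifferentiableAt_atlas (I := 𝓡 n) (chart_mem_atlas (EuclideanSpace ℝ (Fin n)) p) hp)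
  exact (h2.comp y (mdifferentiableAt_chart_symm hy)).differentiableAt

/-- Chain rule: near `y` the inverse chart at `x` is the inverse chart at `p` after the coordinate
change. -/
theorem chartFrame_eq_comp {x p : M} {y : EuclideanSpace ℝ (Fin n)}
    (hy : y ∈ (chartAt (EuclideanSpace ℝ (Fin n)) x).target)
    (hp : (chartAt (EuclideanSpace ℝ (Fin n)) x).symm y ∈
      (chartAt (EuclideanSpace ℝ (Fin n)) p).source) :
    chartFrame x y = (chartFrame p (transition x p y)).comp (fderiv ℝ (transition x p) y) := by
  have hT : transition x p y ∈ (chartAt (EuclideanSpace ℝ (Fin n)) p).target :=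
    (chartAt (EuclideanSpace ℝ (Fin n)) p).map_source hp
  have h1 := (mdifferentiableAt_chart_symm hT).hasMFDerivAt.comp y
    (transition_differentiableAt hy hp).mdifferentiableAt.hasMFDerivAt
  have he : (chartAt (EuclideanSpace ℝ (Fin n)) p).symm ∘ transition x p =ᶠ[nhds y]
      (chartAt (EuclideanSpace ℝ (Fin n)) x).symm := by
    have hc := (chartAt (EuclideanSpace ℝ (Fin n)) x).continuousAt_symm hy
    filter_upwards [hc.preimage_mem_nhds
      ((chartAt (EuclideanSpace ℝ (Fin n)) p).open_source.mem_nhds hp)] with z hz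
    exact (chartAt (EuclideanSpace ℝ (Fin n)) p).left_inv hz
  have h2 := (h1.congr_of_eventuallyEq he.symm).mfderiv
  rw [mfderiv_eq_fderiv] at h2
  exact h2

variable [RiemannianBundle (fun x : M ↦ TangentSpace (𝓡 n) x)]

theorem metricMatrix_posDef {x : M} {y : EuclideanSpace ℝ (Fin n)}
    (hy : y ∈ (chartAt (EuclideanSpace ℝ (Fin n)) x).target) :
    (metricMatrix x y).PosDef := by
  refine Matrix.PosDef.of_dotProduct_mulVec_pos (metricMatrix_isHermitian x y) fun v hv ↦ ?_
  have h := tangentForm_chartFrame' x y (WithLp.toLp 2 v) (WithLp.toLp 2 v)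
  rw [star_trivial, ← h]
  refine tangentForm_self_pos _ fun h0 ↦ hv ?_
  have := chartFrame_injective hy (h0.trans (map_zero _).symm)
  simpa using this

theorem det_metricMatrix_pos {x : M} {y : EuclideanSpace ℝ (Fin n)}
    (hy : y ∈ (chartAt (EuclideanSpace ℝ (Fin n)) x).target) : 0 < (metricMatrix x y).det :=
  (metricMatrix_posDef hy).det_pos

theorem volumeDensity_pos {x : M} {y : EuclideanSpace ℝ (Fin n)}
    (hy : y ∈ (chartAt (EuclideanSpace ℝ (Fin n)) x).target) : 0 < volumeDensity x y :=
  Real.sqrt_pos.2 (det_metricMatrix_pos hy)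

theorem metricMatrix_transition {x p : M} {y : EuclideanSpace ℝ (Fin n)}
    (hy : y ∈ (chartAt (EuclideanSpace ℝ (Fin n)) x).target)
    (hp : (chartAt (EuclideanSpace ℝ (Fin n)) x).symm y ∈
      (chartAt (EuclideanSpace ℝ (Fin n)) p).source) :
    let J := Matrix.of fun i j ↦ fderiv ℝ (transition x p) y (EuclideanSpace.single j 1) i
    metricMatrix x y = J.transpose * metricMatrix p (transition x p y) * J := by
  intro J
  ext i j
  rw [metricMatrix_apply, chartFrame_eq_comp hy hp]
  -- Both frames live over the same point, but only propositionally; the rewrite is possible because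
  -- `tangentForm` acts on the fixed space `ℝⁿ`.
  have hq : (chartAt (EuclideanSpace ℝ (Fin n)) x).symm y =
      (chartAt (EuclideanSpace ℝ (Fin n)) p).symm (transition x p y) :=
    ((chartAt (EuclideanSpace ℝ (Fin n)) p).left_inv hp).symm
  rw [hq, ContinuousLinearMap.comp_apply, ContinuousLinearMap.comp_apply, tangentForm_chartFrame]
  simp only [Matrix.mul_apply, Matrix.transpose_apply, Finset.sum_mul]
  rw [Finset.sum_comm]
  rfl

/-- The metric matrix transforms by congruence with the Jacobian `J`, so its determinant gains `(det
J)²`. The root `|det J|` is exactly the factor in the change of variables formula. -/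
theorem volumeDensity_transition {x p : M} {y : EuclideanSpace ℝ (Fin n)}
    (hy : y ∈ (chartAt (EuclideanSpace ℝ (Fin n)) x).target)
    (hp : (chartAt (EuclideanSpace ℝ (Fin n)) x).symm y ∈
      (chartAt (EuclideanSpace ℝ (Fin n)) p).source) :
    volumeDensity x y =
      |(fderiv ℝ (transition x p) y).det| * volumeDensity p (transition x p y) := by
  have h := metricMatrix_transition hy hp
  set J := Matrix.of fun i j ↦ fderiv ℝ (transition x p) y (EuclideanSpace.single j 1) i with hJ
  have hdet : (fderiv ℝ (transition x p) y).det = J.det := by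
    rw [ContinuousLinearMap.det,
      ← LinearMap.det_toMatrix (EuclideanSpace.basisFun (Fin n) ℝ).toBasis]
    congr 1
  rw [volumeDensity, volumeDensity, h, Matrix.det_mul, Matrix.det_mul, Matrix.det_transpose, hdet,
    show J.det * (metricMatrix p (transition x p y)).det * J.det =
      J.det ^ 2 * (metricMatrix p (transition x p y)).det by ring,
    Real.sqrt_mul (sq_nonneg _), Real.sqrt_sq_eq_abs]

/-- In the chart at `x`, the inner product of gradients is `∑ g^{ij} ∂_i f ∂_j h`. -/
theorem gradInner_eq {f h : M → ℝ} {x : M} {y : EuclideanSpace ℝ (Fin n)}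
    (hy : y ∈ (chartAt (EuclideanSpace ℝ (Fin n)) x).target)
    (hf : MDifferentiableAt (𝓡 n) 𝓘(ℝ, ℝ) f ((chartAt (EuclideanSpace ℝ (Fin n)) x).symm y))
    (hh : MDifferentiableAt (𝓡 n) 𝓘(ℝ, ℝ) h ((chartAt (EuclideanSpace ℝ (Fin n)) x).symm y)) :
    gradInner (n := n) f h ((chartAt (EuclideanSpace ℝ (Fin n)) x).symm y) =
      ∑ i, ∑ j, (metricMatrix x y)⁻¹ i j *
        coordDeriv i (f ∘ (chartAt (EuclideanSpace ℝ (Fin n)) x).symm) y *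
        coordDeriv j (h ∘ (chartAt (EuclideanSpace ℝ (Fin n)) x).symm) y := by
  set q := (chartAt (EuclideanSpace ℝ (Fin n)) x).symm y with hq
  -- If `a` denotes the components of the gradient in the chart frame, pairing with the frame
  -- vectors gives `∂k = G a`, so `a = G⁻¹ ∂k`.
  have key {k : M → ℝ} (hk : MDifferentiableAt (𝓡 n) 𝓘(ℝ, ℝ) k q) :
      ∃ a : EuclideanSpace ℝ (Fin n), chartFrame x y a = gradVector k q ∧
        a.ofLp = (metricMatrix x y)⁻¹.mulVec
          (fun i ↦ coordDeriv i (k ∘ (chartAt (EuclideanSpace ℝ (Fin n)) x).symm) y) := by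
    obtain ⟨a, ha⟩ := chartFrame_surjective hy (gradVector k q)
    refine ⟨a, ha, ?_⟩
    have hD : (fun i ↦ coordDeriv i (k ∘ (chartAt (EuclideanSpace ℝ (Fin n)) x).symm) y) =
        (metricMatrix x y).mulVec a.ofLp := by
      ext i
      have h1 := (hk.hasMFDerivAt.comp y (mdifferentiableAt_chart_symm hy).hasMFDerivAt).mfderiv
      rw [mfderiv_eq_fderiv] at h1
      have h2 : coordDeriv i (k ∘ (chartAt (EuclideanSpace ℝ (Fin n)) x).symm) y =
          mfderiv (𝓡 n) 𝓘(ℝ, ℝ) k q (chartFrame x y (EuclideanSpace.single i 1)) :=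
        DFunLike.congr_fun h1 (EuclideanSpace.single i 1)
      rw [h2, ← tangentForm_gradVector, tangentForm_comm, ← ha, tangentForm_chartFrame']
      simp
    rw [hD, Matrix.mulVec_mulVec, Matrix.nonsing_inv_mul _ (det_metricMatrix_pos hy).ne'.isUnit,
      Matrix.one_mulVec]
  obtain ⟨a, ha, ha'⟩ := key hf
  obtain ⟨b, hb, hb'⟩ := key hh
  have : gradInner (n := n) f h q = tangentForm q (chartFrame x y a) (chartFrame x y b) := by
    rw [ha, hb]; rfl
  rw [this, tangentForm_chartFrame', hb', Matrix.mulVec_mulVec,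
    Matrix.mul_nonsing_inv _ (det_metricMatrix_pos hy).ne'.isUnit, Matrix.one_mulVec, ha']
  have hsymm (i j : Fin n) : (metricMatrix x y)⁻¹ i j = (metricMatrix x y)⁻¹ j i := by
    simpa using ((metricMatrix_isHermitian x y).inv.apply j i)
  simp only [dotProduct, Matrix.mulVec, Finset.sum_mul]
  rw [Finset.sum_comm]
  refine Finset.sum_congr rfl fun i _ ↦ Finset.sum_congr rfl fun j _ ↦ ?_
  rw [hsymm i j]

end PointwiseGeometry

/-! ### Regularity of the metric coefficients, the flux and the gradient pairing. -/

section Smoothness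

theorem contDiffOn_det {E ι : Type*} [NormedAddCommGroup E] [NormedSpace ℝ E] [Fintype ι]
    [DecidableEq ι] {k : WithTop ℕ∞} {s : Set E} {A : E → Matrix ι ι ℝ}
    (hA : ∀ i j, ContDiffOn ℝ k (fun y ↦ A y i j) s) : ContDiffOn ℝ k (fun y ↦ (A y).det) s := by
  simp only [Matrix.det_apply]
  exact ContDiffOn.sum fun σ _ ↦ (contDiffOn_prod fun i _ ↦ hA _ _).const_smul _

/-- Cramer's rule: the entries of the inverse are quotients of determinants. -/
theorem contDiffOn_inv_apply {E ι : Type*} [NormedAddCommGroup E] [NormedSpace ℝ E] [Fintype ι]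
    [DecidableEq ι] {k : WithTop ℕ∞} {s : Set E} {A : E → Matrix ι ι ℝ}
    (hA : ∀ i j, ContDiffOn ℝ k (fun y ↦ A y i j) s) (h0 : ∀ y ∈ s, (A y).det ≠ 0) (i j : ι) :
    ContDiffOn ℝ k (fun y ↦ (A y)⁻¹ i j) s := by
  have h (y : E) : (A y)⁻¹ i j = ((A y).det)⁻¹ * ((A y).updateRow j (Pi.single i 1)).det := by
    rw [Matrix.inv_def, Ring.inverse_eq_inv', Matrix.smul_apply, smul_eq_mul,
      Matrix.adjugate_apply]
  simp only [h]
  refine ((contDiffOn_det hA).inv h0).mul (contDiffOn_det fun a b ↦ ?_)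
  by_cases hab : a = j
  · subst hab
    simpa using contDiffOn_const
  · simpa [Matrix.updateRow_ne hab] using hA a b

variable {n : ℕ} {M : Type*} [TopologicalSpace M] [ChartedSpace (EuclideanSpace ℝ (Fin n)) M]

section

variable [RiemannianBundle (fun x : M ↦ TangentSpace (𝓡 n) x)]

/-- The Laplace-Beltrami operator computed in the chart at `x`, in terms of the coordinates. -/
def chartLaplacian (x : M) (f : M → ℝ) (y : EuclideanSpace ℝ (Fin n)) : ℝ :=
  (volumeDensity x y)⁻¹ * ∑ i : Fin n, ∑ j : Fin n,
    coordDeriv i (fun z ↦ volumeDensity x z * (metricMatrix x z)⁻¹ i j *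
      coordDeriv j (f ∘ (chartAt (EuclideanSpace ℝ (Fin n)) x).symm) z) y

end

variable [IsManifold (𝓡 n) ∞ M]

theorem contDiffOn_comp_chart_symm {k : WithTop ℕ∞} (hk : k ≤ ∞) {f : M → ℝ}
    (hf : ContMDiff (𝓡 n) 𝓘(ℝ, ℝ) k f) (x : M) :
    ContDiffOn ℝ k (f ∘ (chartAt (EuclideanSpace ℝ (Fin n)) x).symm)
      (chartAt (EuclideanSpace ℝ (Fin n)) x).target := by
  rw [← contMDiffOn_iff_contDiffOn]
  exact hf.comp_contMDiffOn ((contMDiffOn_chart_symm (I := 𝓡 n) (n := ∞)).of_le hk)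

theorem contDiffOn_coordDeriv {k l : WithTop ℕ∞} {F : EuclideanSpace ℝ (Fin n) → ℝ}
    {s : Set (EuclideanSpace ℝ (Fin n))} (hs : IsOpen s) (hF : ContDiffOn ℝ l F s)
    (hkl : k + 1 ≤ l) (i : Fin n) : ContDiffOn ℝ k (coordDeriv i F) s :=
  (hF.fderiv_of_isOpen hs hkl).clm_apply contDiffOn_const

variable [RiemannianBundle (fun x : M ↦ TangentSpace (𝓡 n) x)]
  [IsContMDiffRiemannianBundle (𝓡 n) ∞ (EuclideanSpace ℝ (Fin n))
      (fun x : M ↦ TangentSpace (𝓡 n) x)]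

theorem contDiffOn_metricMatrix (x : M) (i j : Fin n) :
    ContDiffOn ℝ 1 (fun y ↦ metricMatrix x y i j)
      (chartAt (EuclideanSpace ℝ (Fin n)) x).target := by
  have ho := (chartAt (EuclideanSpace ℝ (Fin n)) x).open_target
  have hsec (k : Fin n) : ContMDiffOn (𝓡 n) ((𝓡 n).prod (𝓡 n)) 1
      (fun y ↦ (⟨(chartAt (EuclideanSpace ℝ (Fin n)) x).symm y,
        mfderiv (𝓡 n) (𝓡 n) (chartAt (EuclideanSpace ℝ (Fin n)) x).symm y
          (EuclideanSpace.single k (1 : ℝ))⟩ : TangentBundle (𝓡 n) M))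
      (chartAt (EuclideanSpace ℝ (Fin n)) x).target := by
    -- The frame field is the image of a constant vector field under the tangent map of the inverse
    -- chart.
    have h1 := ContMDiffOn.contMDiffOn_tangentMapWithin (m := 1) (n := ∞)
      (contMDiffOn_chart_symm (I := 𝓡 n) (n := ∞) (x := x))
      (by rw [one_add_one_eq_two]; exact ENat.LEInfty.out)
      ho.uniqueMDiffOn
    have h2 : ContMDiff (𝓡 n) ((𝓡 n).prod (𝓡 n)) 1
        (fun y : EuclideanSpace ℝ (Fin n) ↦ (⟨y, EuclideanSpace.single k (1 : ℝ)⟩ :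
          TangentBundle (𝓡 n) (EuclideanSpace ℝ (Fin n)))) :=
      contMDiff_vectorSpace_iff_contDiff.2 contDiff_const
    refine (h1.comp h2.contMDiffOn fun y hy ↦ hy).congr fun y hy ↦ ?_
    simp only [Function.comp_apply, tangentMapWithin, mfderivWithin_of_isOpen ho hy]
  have : IsContMDiffRiemannianBundle (𝓡 n) 1 (EuclideanSpace ℝ (Fin n))
      (fun x : M ↦ TangentSpace (𝓡 n) x) :=
    IsContMDiffRiemannianBundle.of_le (n := ∞) ENat.LEInfty.out
  rw [← contMDiffOn_iff_contDiffOn]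
  exact (hsec i).inner_bundle (hsec j)

theorem contDiffOn_volumeDensity (x : M) :
    ContDiffOn ℝ 1 (volumeDensity x) (chartAt (EuclideanSpace ℝ (Fin n)) x).target :=
  (contDiffOn_det (contDiffOn_metricMatrix x)).sqrt fun _ hy ↦ (det_metricMatrix_pos hy).ne'

theorem contDiffOn_inv_metricMatrix (x : M) (i j : Fin n) :
    ContDiffOn ℝ 1 (fun y ↦ (metricMatrix x y)⁻¹ i j)
      (chartAt (EuclideanSpace ℝ (Fin n)) x).target :=
  contDiffOn_inv_apply (contDiffOn_metricMatrix x) (fun _ hy ↦ (det_metricMatrix_pos hy).ne') i j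

theorem contDiffOn_flux {f : M → ℝ} (hf : ContMDiff (𝓡 n) 𝓘(ℝ, ℝ) 2 f) (x : M) (i j : Fin n) :
    ContDiffOn ℝ 1 (fun z ↦ volumeDensity x z * (metricMatrix x z)⁻¹ i j *
      coordDeriv j (f ∘ (chartAt (EuclideanSpace ℝ (Fin n)) x).symm) z)
      (chartAt (EuclideanSpace ℝ (Fin n)) x).target :=
  ((contDiffOn_volumeDensity x).mul (contDiffOn_inv_metricMatrix x i j)).mul
    (contDiffOn_coordDeriv (chartAt (EuclideanSpace ℝ (Fin n)) x).open_target
      (contDiffOn_comp_chart_symm (ENat.LEInfty.out) hf x) (by norm_num) j)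

theorem continuousOn_chartLaplacian {f : M → ℝ} (hf : ContMDiff (𝓡 n) 𝓘(ℝ, ℝ) 2 f) (x : M) :
    ContinuousOn (chartLaplacian x f) (chartAt (EuclideanSpace ℝ (Fin n)) x).target := by
  refine ((contDiffOn_volumeDensity x).continuousOn.inv₀
    fun _ hy ↦ (volumeDensity_pos hy).ne').mul ?_
  refine continuousOn_finsetSum _ fun i _ ↦ continuousOn_finsetSum _ fun j _ ↦ ?_
  exact (contDiffOn_coordDeriv (chartAt (EuclideanSpace ℝ (Fin n)) x).open_target
    (contDiffOn_flux hf x i j) (k := 0) (by norm_num) i).continuousOn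

theorem continuous_gradInner {f h : M → ℝ} (hf : ContMDiff (𝓡 n) 𝓘(ℝ, ℝ) 1 f)
    (hh : ContMDiff (𝓡 n) 𝓘(ℝ, ℝ) 1 h) : Continuous (gradInner (n := n) f h) := by
  rw [continuous_iff_continuousAt]
  intro x
  set e := chartAt (EuclideanSpace ℝ (Fin n)) x with he
  have hx : x ∈ e.source := mem_chart_source _ x
  have h1 : ContinuousOn (fun y ↦ gradInner (n := n) f h (e.symm y)) e.target := by
    refine ContinuousOn.congr (f := fun y ↦ ∑ i, ∑ j, (metricMatrix x y)⁻¹ i j *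
        coordDeriv i (f ∘ e.symm) y * coordDeriv j (h ∘ e.symm) y) ?_
      fun y hy ↦ gradInner_eq hy (hf.mdifferentiableAt one_ne_zero)
        (hh.mdifferentiableAt one_ne_zero)
    refine continuousOn_finsetSum _ fun i _ ↦ continuousOn_finsetSum _ fun j _ ↦ ?_
    have hd {k : M → ℝ} (hk : ContMDiff (𝓡 n) 𝓘(ℝ, ℝ) 1 k) (l : Fin n) :
        ContinuousOn (coordDeriv l (k ∘ e.symm)) e.target :=
      (contDiffOn_coordDeriv e.open_target
        (contDiffOn_comp_chart_symm (ENat.LEInfty.out) hk x) (k := 0)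
        (by norm_num) l).continuousOn
    exact ((contDiffOn_inv_metricMatrix x i j).continuousOn.mul (hd hf i)).mul (hd hh j)
  have h2 : ContinuousOn (gradInner (n := n) f h) e.source :=
    (h1.comp e.continuousOn fun q hq ↦ e.map_source hq).congr fun q hq ↦ by
      simp [e.left_inv hq]
  exact h2.continuousAt (e.open_source.mem_nhds hx)

end Smoothness

/-! ### Integration by parts on open subsets of `ℝⁿ`. -/

section IntegrationByParts

theorem integrableOn_of_continuousOn_of_compact {X : Type*} [TopologicalSpace X] [T2Space X]
    [MeasurableSpace X] [BorelSpace X] {μ : Measure X} [IsFiniteMeasureOnCompacts μ] {T K : Set X}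
    {F : X → ℝ} (hT : MeasurableSet T) (hF : ContinuousOn F T) (hK : IsCompact K) (hKT : K ⊆ T)
    (h0 : ∀ y ∈ T \ K, F y = 0) : IntegrableOn F T μ :=
  ((hF.mono hKT).integrableOn_compact hK).of_forall_sdiff_eq_zero hT h0

variable {n : ℕ}

theorem coordDeriv_eq_zero {T K : Set (EuclideanSpace ℝ (Fin n))} (hT : IsOpen T)
    (hK : IsClosed K) {F : EuclideanSpace ℝ (Fin n) → ℝ} (h0 : ∀ y ∈ T \ K, F y = 0) (i : Fin n) :
    ∀ y ∈ T \ K, coordDeriv i F y = 0 := by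
  intro y hy
  have : F =ᶠ[nhds y] fun _ ↦ 0 := by
    filter_upwards [(hT.sdiff hK).mem_nhds hy] with z hz using h0 z hz
  rw [coordDeriv, this.fderiv_eq]
  simp

theorem integral_coordDeriv_eq_zero {F : EuclideanSpace ℝ (Fin n) → ℝ} (hF : ContDiff ℝ 1 F)
    (hc : HasCompactSupport F) (i : Fin n) : ∫ y, coordDeriv i F y = 0 := by
  have hcont : Continuous (coordDeriv i F) :=
    (hF.continuous_fderiv one_ne_zero).clm_apply continuous_const
  have hcs : HasCompactSupport (coordDeriv i F) := hc.fderiv_apply ℝ _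
  have hint : Integrable (fun y ↦ fderiv ℝ F y (EuclideanSpace.single i 1)) :=
    hcont.integrable_of_hasCompactSupport (μ := volume) hcs
  -- Integrating by parts against the constant `1`.
  have h := integral_mul_fderiv_eq_neg_fderiv_mul_of_integrable (μ := volume) (𝕜 := ℝ) (f := F)
    (g := fun _ ↦ 1) (v := EuclideanSpace.single i 1) (by simpa using hint) (by simp)
    (by simpa using hF.continuous.integrable_of_hasCompactSupport hc)
    (fun x _ ↦ (hF.differentiable one_ne_zero) x) (fun x _ ↦ differentiableAt_const _)
  simpa [coordDeriv] using h

/-- Integration by parts on an open subset of `ℝⁿ`, one of the functions being compactly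
supported in it. -/
theorem setIntegral_mul_coordDeriv {T K : Set (EuclideanSpace ℝ (Fin n))} (hT : IsOpen T)
    (hK : IsCompact K) (hKT : K ⊆ T) {F W : EuclideanSpace ℝ (Fin n) → ℝ}
    (hF : ContDiffOn ℝ 1 F T) (hW : ContDiffOn ℝ 1 W T) (h0 : ∀ y ∈ T \ K, F y = 0) (i : Fin n) :
    IntegrableOn (fun y ↦ F y * coordDeriv i W y) T ∧
    IntegrableOn (fun y ↦ coordDeriv i F y * W y) T ∧
    ∫ y in T, F y * coordDeriv i W y = - ∫ y in T, coordDeriv i F y * W y := by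
  have hF' := (contDiffOn_coordDeriv hT hF (k := 0) (by norm_num) i).continuousOn
  have hW' := (contDiffOn_coordDeriv hT hW (k := 0) (by norm_num) i).continuousOn
  have h0' := coordDeriv_eq_zero hT hK.isClosed h0 i
  have i1 : IntegrableOn (fun y ↦ F y * coordDeriv i W y) T :=
    integrableOn_of_continuousOn_of_compact hT.measurableSet (hF.continuousOn.mul hW') hK hKT
      fun y hy ↦ by simp [h0 y hy]
  have i2 : IntegrableOn (fun y ↦ coordDeriv i F y * W y) T :=
    integrableOn_of_continuousOn_of_compact hT.measurableSet (hF'.mul hW.continuousOn) hK hKT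
      fun y hy ↦ by simp [h0' y hy]
  refine ⟨i1, i2, ?_⟩
  -- Nothing is known of `F` and `W` outside `T`, so the product is extended by zero. It vanishes
  -- near every point off `K`, hence the extension is `C¹` on all of `ℝⁿ`.
  set P : EuclideanSpace ℝ (Fin n) → ℝ := T.indicator fun y ↦ F y * W y with hP
  have hPK : ∀ y ∉ K, P y = 0 := fun y hy ↦ by
    by_cases hyT : y ∈ T
    · simp [hP, hyT, h0 y ⟨hyT, hy⟩]
    · simp [hP, hyT]
  have hPT : ∀ y ∈ T, P =ᶠ[nhds y] fun y ↦ F y * W y := fun y hy ↦ by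
    filter_upwards [hT.mem_nhds hy] with z hz
    simp [hP, hz]
  have hPK' : ∀ y ∉ K, P =ᶠ[nhds y] fun _ ↦ 0 := fun y hy ↦ by
    filter_upwards [hK.isClosed.isOpen_compl.mem_nhds hy] with z hz using hPK z hz
  have hPc : HasCompactSupport P := HasCompactSupport.intro hK hPK
  have hPd : ContDiff ℝ 1 P := by
    rw [contDiff_iff_contDiffAt]
    intro y
    by_cases hy : y ∈ K
    · exact ((hF.mul hW).contDiffAt (hT.mem_nhds (hKT hy))).congr_of_eventuallyEq
        (hPT y (hKT hy))
    · exact contDiffAt_const.congr_of_eventuallyEq (hPK' y hy)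
  have h := integral_coordDeriv_eq_zero hPd hPc i
  rw [← setIntegral_eq_integral_of_forall_compl_eq_zero (s := T)] at h
  · rw [setIntegral_congr_fun (g := fun y ↦ F y * coordDeriv i W y + coordDeriv i F y * W y)
      hT.measurableSet, integral_add i1 i2] at h
    · linarith
    · intro y hy
      have hFd := (hF.contDiffAt (hT.mem_nhds hy)).differentiableAt one_ne_zero
      have hWd := (hW.contDiffAt (hT.mem_nhds hy)).differentiableAt one_ne_zero
      simp only [coordDeriv, (hPT y hy).fderiv_eq]
      rw [fderiv_fun_mul hFd hWd]
      simp
      ring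
  · intro y hy
    rw [coordDeriv, (hPK' y fun h ↦ hy (hKT h)).fderiv_eq]
    simp

end IntegrationByParts

/-! ### The Riemannian volume measure in charts. -/

section VolumeMeasure

variable {n : ℕ} {M : Type*} [TopologicalSpace M] [ChartedSpace (EuclideanSpace ℝ (Fin n)) M]
  [MeasurableSpace M] [BorelSpace M]

theorem measurableSet_target_inter_preimage (x : M) {A : Set M} (hA : MeasurableSet A) :
    MeasurableSet ((chartAt (EuclideanSpace ℝ (Fin n)) x).target ∩
        (chartAt (EuclideanSpace ℝ (Fin n)) x).symm ⁻¹' A) := by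
  set e := chartAt (EuclideanSpace ℝ (Fin n)) x
  have h := (continuousOn_iff_continuous_domRestrict.1 e.continuousOn_symm).measurable hA
  have h2 := (MeasurableEmbedding.subtype_coe e.open_target.measurableSet).measurableSet_image.2 h
  convert h2 using 1
  ext y
  simp [and_comm]

variable [RiemannianBundle (fun x : M ↦ TangentSpace (𝓡 n) x)]

theorem aemeasurable_chart_symm {x : M} :
    AEMeasurable (chartAt (EuclideanSpace ℝ (Fin n)) x).symm
      ((volume.restrict (chartAt (EuclideanSpace ℝ (Fin n)) x).target).withDensity
        (fun y ↦ ENNReal.ofReal (volumeDensity x y))) :=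
  ((chartAt (EuclideanSpace ℝ (Fin n)) x).continuousOn_symm.aemeasurable
    (chartAt (EuclideanSpace ℝ (Fin n)) x).open_target.measurableSet).mono_ac
      (withDensity_absolutelyContinuous _ _)

theorem chartVolume_apply (x : M) {A : Set M} (hA : MeasurableSet A) :
    chartVolume (n := n) x A =
      ∫⁻ y in (chartAt (EuclideanSpace ℝ (Fin n)) x).target ∩
        (chartAt (EuclideanSpace ℝ (Fin n)) x).symm ⁻¹' A,
        ENNReal.ofReal (volumeDensity x y) := by
  rw [chartVolume, Measure.map_apply_of_aemeasurable aemeasurable_chart_symm hA,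
    withDensity_apply', Measure.restrict_restrict'
      (chartAt (EuclideanSpace ℝ (Fin n)) x).open_target.measurableSet, Set.inter_comm]

/-- The measures of two charts agree on the overlap. -/
theorem chartVolume_eq_chartVolume [IsManifold (𝓡 n) ∞ M] {x p : M} {A : Set M}
    (hA : MeasurableSet A) (hx : A ⊆ (chartAt (EuclideanSpace ℝ (Fin n)) x).source)
    (hp : A ⊆ (chartAt (EuclideanSpace ℝ (Fin n)) p).source) :
    chartVolume (n := n) x A = chartVolume (n := n) p A := by
  rw [chartVolume_apply x hA, chartVolume_apply p hA]
  set B := (chartAt (EuclideanSpace ℝ (Fin n)) x).target ∩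
        (chartAt (EuclideanSpace ℝ (Fin n)) x).symm ⁻¹' A with hB
  have himg : (chartAt (EuclideanSpace ℝ (Fin n)) p).target ∩
      (chartAt (EuclideanSpace ℝ (Fin n)) p).symm ⁻¹' A = transition x p '' B := by
    ext z
    constructor
    · rintro ⟨hz, hzA⟩
      refine ⟨chartAt (EuclideanSpace ℝ (Fin n)) x
        ((chartAt (EuclideanSpace ℝ (Fin n)) p).symm z), ⟨?_, ?_⟩, ?_⟩
      · exact (chartAt _ x).map_source (hx hzA)
      · simpa [(chartAt (EuclideanSpace ℝ (Fin n)) x).left_inv (hx hzA)] using hzA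
      · simp [transition, (chartAt (EuclideanSpace ℝ (Fin n)) x).left_inv (hx hzA),
          (chartAt (EuclideanSpace ℝ (Fin n)) p).right_inv hz]
    · rintro ⟨y, ⟨hy, hyA⟩, rfl⟩
      refine ⟨(chartAt _ p).map_source (hp hyA), ?_⟩
      simpa [transition, (chartAt (EuclideanSpace ℝ (Fin n)) p).left_inv (hp hyA)] using hyA
  have hBm : MeasurableSet B := measurableSet_target_inter_preimage x hA
  have hinj : Set.InjOn (transition x p) B := by
    rintro y ⟨hy, hyA⟩ z ⟨hz, hzA⟩ hyz
    have := (chartAt (EuclideanSpace ℝ (Fin n)) p).injOn (hp hyA) (hp hzA) hyz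
    exact (chartAt (EuclideanSpace ℝ (Fin n)) x).symm.injOn hy hz this
  -- Change of variables along the transition map; its Jacobian is absorbed by
  -- `volumeDensity_transition`.
  rw [himg, lintegral_image_eq_lintegral_abs_det_fderiv_mul volume hBm
    (f' := fderiv ℝ (transition x p))
    (fun y hy ↦ (transition_differentiableAt hy.1 (hp hy.2)).hasFDerivAt.hasFDerivWithinAt) hinj]
  refine setLIntegral_congr_fun hBm fun y hy ↦ ?_
  rw [volumeDensity_transition hy.1 (hp hy.2), ENNReal.ofReal_mul (abs_nonneg _)]

variable [SecondCountableTopology M] [Nonempty M] [IsManifold (𝓡 n) ∞ M]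

/-- Each disjointed piece of `A` lies both in a chart of the covering sequence and in the chart at
`x`, where the two chart measures agree; countable additivity does the rest. -/
theorem riemannianVolume_apply {x : M} {A : Set M} (hA : MeasurableSet A)
    (hx : A ⊆ (chartAt (EuclideanSpace ℝ (Fin n)) x).source) :
    riemannianVolume n M A = chartVolume (n := n) x A := by
  set D := disjointed (fun l ↦ (chartAt (EuclideanSpace ℝ (Fin n)) (chartSeq n M l)).source)
    with hD
  have hDm (k : ℕ) : MeasurableSet (D k) :=
    MeasurableSet.disjointed (fun l ↦ (chartAt (EuclideanSpace ℝ (Fin n))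
      (chartSeq n M l)).open_source.measurableSet) k
  have hU : ⋃ k, A ∩ D k = A := by
    rw [← Set.inter_iUnion, hD, iUnion_disjointed, chartSeq, (exists_chartSeq n M).choose_spec,
      Set.inter_univ]
  rw [riemannianVolume, Measure.sum_apply _ hA]
  conv_rhs => rw [← hU]
  rw [measure_iUnion (fun i j hij ↦ (disjoint_disjointed _ hij).mono Set.inter_subset_right
    Set.inter_subset_right) fun k ↦ hA.inter (hDm k)]
  refine tsum_congr fun k ↦ ?_
  rw [Measure.restrict_apply hA]
  exact chartVolume_eq_chartVolume (hA.inter (hDm k))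
    (Set.inter_subset_right.trans (disjointed_subset _ _)) (Set.inter_subset_left.trans hx)

theorem riemannianVolume_restrict_source (x : M) :
    (riemannianVolume n M).restrict (chartAt (EuclideanSpace ℝ (Fin n)) x).source =
      chartVolume (n := n) x := by
  have hs := (chartAt (EuclideanSpace ℝ (Fin n)) x).open_source.measurableSet
  ext A hA
  rw [Measure.restrict_apply hA, riemannianVolume_apply (hA.inter hs) Set.inter_subset_right,
    chartVolume_apply x (hA.inter hs), chartVolume_apply x hA]
  congr 2
  ext y
  simp only [Set.mem_inter_iff, Set.mem_preimage]
  exact ⟨fun h ↦ ⟨h.1, h.2.1⟩, fun h ↦ ⟨h.1, h.2, (chartAt _ x).map_target h.1⟩⟩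

variable [IsContMDiffRiemannianBundle (𝓡 n) ∞ (EuclideanSpace ℝ (Fin n))
      (fun x : M ↦ TangentSpace (𝓡 n) x)]

/-- The integral of a function supported in a chart, in coordinates. -/
theorem integral_eq_setIntegral_chart {x : M} {F : M → ℝ}
    (hF : ContinuousOn F (chartAt (EuclideanSpace ℝ (Fin n)) x).source)
    (h0 : ∀ q ∉ (chartAt (EuclideanSpace ℝ (Fin n)) x).source, F q = 0) :
    ∫ q, F q ∂(riemannianVolume n M) =
      ∫ y in (chartAt (EuclideanSpace ℝ (Fin n)) x).target,
        volumeDensity x y * F ((chartAt (EuclideanSpace ℝ (Fin n)) x).symm y) := by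
  have hs := (chartAt (EuclideanSpace ℝ (Fin n)) x).open_source.measurableSet
  have hT := (chartAt (EuclideanSpace ℝ (Fin n)) x).open_target.measurableSet
  have hm : AEStronglyMeasurable F (chartVolume (n := n) x) := by
    rw [← riemannianVolume_restrict_source]
    exact hF.aestronglyMeasurable hs
  rw [← setIntegral_eq_integral_of_forall_compl_eq_zero h0, riemannianVolume_restrict_source]
  rw [chartVolume] at hm ⊢
  rw [integral_map aemeasurable_chart_symm hm, integral_withDensity_eq_integral_toReal_smul₀
    ((contDiffOn_volumeDensity x).continuousOn.aemeasurable hT).ennreal_ofReal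
    (by simp)]
  refine setIntegral_congr_fun hT fun y hy ↦ ?_
  rw [ENNReal.toReal_ofReal (volumeDensity_pos hy).le, smul_eq_mul]

/-- The density is continuous, hence integrable over the coordinate image of a compact neighbourhood
inside a chart. -/
theorem isLocallyFiniteMeasure_riemannianVolume [T2Space M] :
    IsLocallyFiniteMeasure (riemannianVolume n M) := by
  have := ChartedSpace.locallyCompactSpace (EuclideanSpace ℝ (Fin n)) M
  refine ⟨fun p ↦ ?_⟩
  set e := chartAt (EuclideanSpace ℝ (Fin n)) p with he
  obtain ⟨K, hKn, hKs, hK⟩ := local_compact_nhds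
    (e.open_source.mem_nhds (mem_chart_source (EuclideanSpace ℝ (Fin n)) p))
  refine ⟨K, hKn, ?_⟩
  rw [riemannianVolume_apply hK.measurableSet hKs, chartVolume_apply p hK.measurableSet]
  have hpre : e.target ∩ e.symm ⁻¹' K = e '' K := by
    exact (e.image_eq_target_inter_inv_preimage hKs).symm
  rw [hpre]
  have hc : IsCompact (e '' K) := hK.image_of_continuousOn (e.continuousOn.mono hKs)
  have hsub : e '' K ⊆ e.target := by
    rintro _ ⟨q, hq, rfl⟩
    exact e.map_source (hKs hq)
  exact (((contDiffOn_volumeDensity p).continuousOn.mono hsub).integrableOn_compact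
    hc).lintegral_lt_top

/-- The density is positive, so a null open set would have Lebesgue-null coordinate images. This is
what later upgrades a.e. equality of continuous functions to equality. -/
theorem isOpenPosMeasure_riemannianVolume : (riemannianVolume n M).IsOpenPosMeasure := by
  refine ⟨fun U hU ⟨p, hp⟩ h0 ↦ ?_⟩
  set e := chartAt (EuclideanSpace ℝ (Fin n)) p with he
  have hA : IsOpen (U ∩ e.source) := hU.inter e.open_source
  have h1 : riemannianVolume n M (U ∩ e.source) = 0 := measure_mono_null Set.inter_subset_left h0
  rw [riemannianVolume_apply hA.measurableSet Set.inter_subset_right,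
    chartVolume_apply p hA.measurableSet] at h1
  have hB : IsOpen (e.target ∩ e.symm ⁻¹' (U ∩ e.source)) :=
    e.continuousOn_symm.isOpen_inter_preimage e.open_target hA
  have hps : p ∈ e.source := mem_chart_source _ p
  rw [lintegral_eq_zero_iff' (((contDiffOn_volumeDensity p).continuousOn.mono
    Set.inter_subset_left).aemeasurable hB.measurableSet).ennreal_ofReal,
    Filter.EventuallyEq, ae_restrict_iff' hB.measurableSet] at h1
  have h2 : volume (e.target ∩ e.symm ⁻¹' (U ∩ e.source)) = 0 := by
    refine measure_mono_null (fun y hy ↦ ?_) h1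
    intro h
    have := h hy
    simp only [Pi.zero_apply, ENNReal.ofReal_eq_zero] at this
    exact absurd (volumeDensity_pos hy.1) this.not_gt
  refine (hB.measure_pos volume ⟨e p, e.map_source hps, ?_⟩).ne' h2
  simpa [e.left_inv hps] using ⟨hp, hps⟩

end VolumeMeasure

/-! ### Product rule for gradients and the pointwise inequality. -/

section GradientCalculus

variable {n : ℕ} {M : Type*} [TopologicalSpace M] [ChartedSpace (EuclideanSpace ℝ (Fin n)) M]
  [RiemannianBundle (fun x : M ↦ TangentSpace (𝓡 n) x)]

theorem gradInner_comm (f h : M → ℝ) (q : M) :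
    gradInner (n := n) f h q = gradInner (n := n) h f q :=
  tangentForm_comm q (gradVector f q) (gradVector h q)

theorem gradInner_self_nonneg (f : M → ℝ) (q : M) : 0 ≤ gradInner (n := n) f f q := by
  rw [gradInner_self]
  positivity

theorem gradInner_eq_mfderiv (f h : M → ℝ) (q : M) :
    gradInner (n := n) f h q = mfderiv (𝓡 n) 𝓘(ℝ, ℝ) f q (gradVector h q) :=
  tangentForm_gradVector f q (gradVector h q)

theorem gradInner_add_left {f g h : M → ℝ} {q : M} (hf : MDifferentiableAt (𝓡 n) 𝓘(ℝ, ℝ) f q)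
    (hg : MDifferentiableAt (𝓡 n) 𝓘(ℝ, ℝ) g q) :
    gradInner (n := n) (f + g) h q = gradInner (n := n) f h q + gradInner (n := n) g h q := by
  simp only [gradInner_eq_mfderiv]
  exact DFunLike.congr_fun (mfderiv_add hf hg) (gradVector h q)

theorem gradInner_mul_left {f g h : M → ℝ} {q : M} (hf : MDifferentiableAt (𝓡 n) 𝓘(ℝ, ℝ) f q)
    (hg : MDifferentiableAt (𝓡 n) 𝓘(ℝ, ℝ) g q) :
    gradInner (n := n) (f * g) h q =
      f q * gradInner (n := n) g h q + g q * gradInner (n := n) f h q := by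
  simp only [gradInner_eq_mfderiv]
  exact DFunLike.congr_fun (hf.hasMFDerivAt.mul hg.hasMFDerivAt).mfderiv (gradVector h q)

theorem gradInner_eq_zero_of_notMem_tsupport {f h : M → ℝ} {q : M} (hq : q ∉ tsupport f) :
    gradInner (n := n) f h q = 0 := by
  have h0 : f =ᶠ[nhds q] fun _ ↦ 0 := notMem_tsupport_iff_eventuallyEq.1 hq
  rw [gradInner_eq_mfderiv, h0.mfderiv_eq]
  exact DFunLike.congr_fun (mfderiv_const (I := 𝓡 n) (I' := 𝓘(ℝ, ℝ)) (c := (0 : ℝ)) (x := q))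
    (gradVector h q)

/-- The pointwise inequality behind the stability inequality, for `φ = χ ζ` and the test function
`χ φ = φ² / ζ`. -/
theorem gradInner_mul_mul_le {χ ζ : M → ℝ} {q : M} (hχ : MDifferentiableAt (𝓡 n) 𝓘(ℝ, ℝ) χ q)
    (hζ : MDifferentiableAt (𝓡 n) 𝓘(ℝ, ℝ) ζ q) :
    gradInner (n := n) (χ * (χ * ζ)) ζ q ≤ gradInner (n := n) (χ * ζ) (χ * ζ) q := by
  have hφ := hχ.mul hζ
  rw [gradInner_mul_left hχ hφ, gradInner_mul_left hχ hζ, gradInner_mul_left hχ hζ,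
    gradInner_comm ζ (χ * ζ), gradInner_comm χ (χ * ζ), gradInner_mul_left hχ hζ,
    gradInner_mul_left hχ hζ, gradInner_comm ζ χ, Pi.mul_apply]
  -- After expansion the two sides differ by exactly `ζ² |∇χ|²`.
  nlinarith [mul_nonneg (sq_nonneg (ζ q)) (gradInner_self_nonneg (n := n) χ q)]

end GradientCalculus

/-! ### Green's formula and chart independence of the Laplacian. -/

section Green

variable {n : ℕ} {M : Type*} [TopologicalSpace M] [ChartedSpace (EuclideanSpace ℝ (Fin n)) M]
  [RiemannianBundle (fun x : M ↦ TangentSpace (𝓡 n) x)]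
  [MeasurableSpace M] [BorelSpace M]
  [SecondCountableTopology M] [Nonempty M] [IsManifold (𝓡 n) ∞ M]
  [IsContMDiffRiemannianBundle (𝓡 n) ∞ (EuclideanSpace ℝ (Fin n))
      (fun x : M ↦ TangentSpace (𝓡 n) x)]

/-- Green's formula for a test function supported in a chart. -/
theorem integral_mul_chartLaplacian {f ψ : M → ℝ} (hf : ContMDiff (𝓡 n) 𝓘(ℝ, ℝ) 2 f)
    (hψ : ContMDiff (𝓡 n) 𝓘(ℝ, ℝ) 1 ψ) (hc : HasCompactSupport ψ) {x : M}
    (hs : tsupport ψ ⊆ (chartAt (EuclideanSpace ℝ (Fin n)) x).source) :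
    ∫ q, ψ q * chartLaplacian x f (chartAt (EuclideanSpace ℝ (Fin n)) x q)
        ∂(riemannianVolume n M) =
      - ∫ q, gradInner (n := n) ψ f q ∂(riemannianVolume n M) := by
  set e := chartAt (EuclideanSpace ℝ (Fin n)) x with he
  have h1 : ContinuousOn (fun q ↦ ψ q * chartLaplacian x f (e q)) e.source :=
    hψ.continuous.continuousOn.mul
      ((continuousOn_chartLaplacian hf x).comp e.continuousOn fun q hq ↦ e.map_source hq)
  have h2 : ContinuousOn (gradInner (n := n) ψ f) e.source :=
    (continuous_gradInner hψ (hf.of_le one_le_two)).continuousOn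
  rw [integral_eq_setIntegral_chart h1 fun q hq ↦ by
      rw [image_eq_zero_of_notMem_tsupport fun h ↦ hq (hs h), zero_mul],
    integral_eq_setIntegral_chart h2 fun q hq ↦
      gradInner_eq_zero_of_notMem_tsupport fun h ↦ hq (hs h), ← he]
  set K := e '' tsupport ψ with hK
  have hKc : IsCompact K := IsCompact.image_of_continuousOn hc (e.continuousOn.mono hs)
  have hKT : K ⊆ e.target := by
    rintro _ ⟨q, hq, rfl⟩
    exact e.map_source (hs hq)
  have h0 : ∀ y ∈ e.target \ K, (ψ ∘ e.symm) y = 0 := fun y hy ↦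
    image_eq_zero_of_notMem_tsupport (f := ψ) fun h ↦ hy.2 ⟨_, h, e.right_inv hy.1⟩
  have ibp (i j : Fin n) := setIntegral_mul_coordDeriv e.open_target hKc hKT
    (contDiffOn_comp_chart_symm (k := 1) ENat.LEInfty.out hψ x) (contDiffOn_flux hf x i j) h0 i
  -- The volume factor `√|g|` cancels the prefactor `1/√|g|`, leaving a pure divergence.
  have hL : ∀ y ∈ e.target, volumeDensity x y *
      (ψ (e.symm y) * chartLaplacian x f (e (e.symm y))) =
      ∑ i, ∑ j, (ψ ∘ e.symm) y * coordDeriv i (fun z ↦ volumeDensity x z *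
        (metricMatrix x z)⁻¹ i j * coordDeriv j (f ∘ e.symm) z) y := by
    intro y hy
    have hv := (volumeDensity_pos hy).ne'
    rw [e.right_inv hy, chartLaplacian, ← he]
    simp only [← Finset.mul_sum, Function.comp_apply]
    field_simp
  have hR : ∀ y ∈ e.target, volumeDensity x y * gradInner (n := n) ψ f (e.symm y) =
      ∑ i, ∑ j, coordDeriv i (ψ ∘ e.symm) y * (volumeDensity x y *
        (metricMatrix x y)⁻¹ i j * coordDeriv j (f ∘ e.symm) y) := by
    intro y hy
    rw [gradInner_eq hy (hψ.mdifferentiableAt one_ne_zero) (hf.mdifferentiableAt two_ne_zero),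
      Finset.mul_sum]
    refine Finset.sum_congr rfl fun i _ ↦ ?_
    rw [Finset.mul_sum]
    refine Finset.sum_congr rfl fun j _ ↦ by ring
  rw [setIntegral_congr_fun e.open_target.measurableSet hL,
    setIntegral_congr_fun e.open_target.measurableSet hR,
    integral_finsetSum _ fun i _ ↦ integrable_finsetSum _ fun j _ ↦ (ibp i j).1,
    integral_finsetSum _ fun i _ ↦ integrable_finsetSum _ fun j _ ↦ (ibp i j).2.1,
    ← Finset.sum_neg_distrib]
  refine Finset.sum_congr rfl fun i _ ↦ ?_
  rw [integral_finsetSum _ fun j _ ↦ (ibp i j).1, integral_finsetSum _ fun j _ ↦ (ibp i j).2.1,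
    ← Finset.sum_neg_distrib]
  exact Finset.sum_congr rfl fun j _ ↦ (ibp i j).2.2

variable [T2Space M]

/-- The product vanishes off `tsupport ψ ⊆ U`, so it is continuous on all of `M` even though `a`
need not be. -/
theorem integrable_mul_of_continuousOn {ψ a : M → ℝ} {U : Set M} (hψ : Continuous ψ)
    (hc : HasCompactSupport ψ) (hU : IsOpen U) (hs : tsupport ψ ⊆ U) (ha : ContinuousOn a U) :
    Integrable (fun q ↦ ψ q * a q) (riemannianVolume n M) := by
  have := isLocallyFiniteMeasure_riemannianVolume (n := n) (M := M)
  have hcont : Continuous (fun q ↦ ψ q * a q) :=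
    continuous_of_tsupport fun q hq ↦ hψ.continuousAt.mul
      (ha.continuousAt (hU.mem_nhds (hs (tsupport_mul_subset_left hq))))
  exact hcont.integrable_of_hasCompactSupport hc.mul_right

/-- The Laplace-Beltrami operator does not depend on the chart. -/
theorem chartLaplacian_eq_laplaceBeltrami {f : M → ℝ} (hf : ContMDiff (𝓡 n) 𝓘(ℝ, ℝ) 2 f) {x p : M}
    (hp : p ∈ (chartAt (EuclideanSpace ℝ (Fin n)) x).source) :
    chartLaplacian x f (chartAt (EuclideanSpace ℝ (Fin n)) x p) =
      laplaceBeltrami (n := n) f p := by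
  have := isLocallyFiniteMeasure_riemannianVolume (n := n) (M := M)
  have := isOpenPosMeasure_riemannianVolume (n := n) (M := M)
  have := ChartedSpace.locallyCompactSpace (EuclideanSpace ℝ (Fin n)) M
  set U := (chartAt (EuclideanSpace ℝ (Fin n)) x).source ∩
    (chartAt (EuclideanSpace ℝ (Fin n)) p).source with hU
  have hUo : IsOpen U := (chartAt _ x).open_source.inter (chartAt _ p).open_source
  have hcont (z : M) : ContinuousOn
      (fun q ↦ chartLaplacian z f (chartAt (EuclideanSpace ℝ (Fin n)) z q))
      (chartAt (EuclideanSpace ℝ (Fin n)) z).source :=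
    (continuousOn_chartLaplacian hf z).comp (chartAt _ z).continuousOn
      fun q hq ↦ (chartAt _ z).map_source hq
  have hx := (hcont x).mono (Set.inter_subset_left : U ⊆ _)
  have hp' := (hcont p).mono (Set.inter_subset_right : U ⊆ _)
  -- Instead of transforming second derivatives, the two expressions are compared weakly: Green's
  -- formula in either chart has the same intrinsic right side.
  have hae := hUo.ae_eq_zero_of_integral_contMDiff_smul_eq_zero (𝓡 n)
    (μ := riemannianVolume n M) ((hx.sub hp').locallyIntegrableOn hUo.measurableSet) ?_
  · have hae' : (fun q ↦ chartLaplacian x f (chartAt (EuclideanSpace ℝ (Fin n)) x q))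
        =ᵐ[(riemannianVolume n M).restrict U]
        (fun q ↦ chartLaplacian p f (chartAt (EuclideanSpace ℝ (Fin n)) p q)) := by
      rw [Filter.EventuallyEq, ae_restrict_iff' hUo.measurableSet]
      filter_upwards [hae] with q hq hqU using sub_eq_zero.1 (hq hqU)
    exact Measure.eqOn_open_of_ae_eq hae' hUo hx hp' ⟨hp, mem_chart_source _ p⟩
  · intro g hg hgc hgU
    have hg1 : ContMDiff (𝓡 n) 𝓘(ℝ, ℝ) 1 g := hg.of_le ENat.LEInfty.out
    simp only [Pi.sub_apply, smul_eq_mul, mul_sub]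
    rw [integral_sub (integrable_mul_of_continuousOn hg.continuous hgc hUo hgU hx)
      (integrable_mul_of_continuousOn hg.continuous hgc hUo hgU hp'),
      integral_mul_chartLaplacian hf hg1 hgc (hgU.trans Set.inter_subset_left),
      integral_mul_chartLaplacian hf hg1 hgc (hgU.trans Set.inter_subset_right), sub_self]

/-- The defining chart varies with the point; continuity becomes visible once the chart is fixed
near `p`. -/
theorem continuous_laplaceBeltrami {f : M → ℝ} (hf : ContMDiff (𝓡 n) 𝓘(ℝ, ℝ) 2 f) :
    Continuous (laplaceBeltrami (n := n) f) := by
  rw [continuous_iff_continuousAt]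
  intro p
  set e := chartAt (EuclideanSpace ℝ (Fin n)) p
  have h : ContinuousOn (laplaceBeltrami (n := n) f) e.source :=
    ((continuousOn_chartLaplacian hf p).comp e.continuousOn fun q hq ↦ e.map_source hq).congr
      fun q hq ↦ (chartLaplacian_eq_laplaceBeltrami hf hq).symm
  exact h.continuousAt (e.open_source.mem_nhds (mem_chart_source _ p))

theorem integrable_gradInner {f h : M → ℝ} (hf : ContMDiff (𝓡 n) 𝓘(ℝ, ℝ) 1 f)
    (hc : HasCompactSupport f) (hh : ContMDiff (𝓡 n) 𝓘(ℝ, ℝ) 1 h) :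
    Integrable (gradInner (n := n) f h) (riemannianVolume n M) := by
  have := isLocallyFiniteMeasure_riemannianVolume (n := n) (M := M)
  exact (continuous_gradInner hf hh).integrable_of_hasCompactSupport
    (HasCompactSupport.intro hc fun q hq ↦ gradInner_eq_zero_of_notMem_tsupport hq)

/-- Green's formula on a Riemannian manifold, for a compactly supported test function. -/
theorem integral_mul_laplaceBeltrami {f ψ : M → ℝ} (hf : ContMDiff (𝓡 n) 𝓘(ℝ, ℝ) 2 f)
    (hψ : ContMDiff (𝓡 n) 𝓘(ℝ, ℝ) 1 ψ) (hc : HasCompactSupport ψ) :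
    ∫ q, ψ q * laplaceBeltrami (n := n) f q ∂(riemannianVolume n M) =
      - ∫ q, gradInner (n := n) ψ f q ∂(riemannianVolume n M) := by
  have := ChartedSpace.locallyCompactSpace (EuclideanSpace ℝ (Fin n)) M
  have hf1 : ContMDiff (𝓡 n) 𝓘(ℝ, ℝ) 1 f := hf.of_le one_le_two
  obtain ⟨ρ, hρ⟩ := SmoothPartitionOfUnity.exists_isSubordinate_chartAt_source (𝓡 n) M
  -- Local finiteness leaves only finitely many members of the partition that meet the compact
  -- support.
  have hfin := ρ.locallyFinite.finite_nonempty_inter_compact hc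
  set s := hfin.toFinset with hs
  have hsum : ∑ i ∈ s, (⇑(ρ i) * ψ) = ψ := by
    ext q
    simp only [Finset.sum_apply, Pi.mul_apply, ← Finset.sum_mul]
    by_cases hq : q ∈ tsupport ψ
    · have h1 := ρ.sum_eq_one (Set.mem_univ q)
      rw [finsum_eq_sum_of_support_subset (s := s)] at h1
      · rw [h1, one_mul]
      · intro i hi
        simp only [hs, Set.Finite.coe_toFinset, Set.mem_ofPred_eq]
        exact ⟨q, hi, hq⟩
    · rw [image_eq_zero_of_notMem_tsupport hq, mul_zero]
  -- Regularity and compact support are carried along, since additivity of the integrals needs them.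
  let P : (M → ℝ) → Prop := fun θ ↦ ContMDiff (𝓡 n) 𝓘(ℝ, ℝ) 1 θ ∧ HasCompactSupport θ ∧
    ∫ q, θ q * laplaceBeltrami (n := n) f q ∂(riemannianVolume n M) =
      - ∫ q, gradInner (n := n) θ f q ∂(riemannianVolume n M)
  have hP : P (∑ i ∈ s, (⇑(ρ i) * ψ)) := by
    refine Finset.sum_induction _ P ?_ ?_ ?_
    · rintro θ η ⟨h1, h2, h3⟩ ⟨k1, k2, k3⟩
      refine ⟨h1.add k1, h2.add k2, ?_⟩
      have hint {θ : M → ℝ} (h1 : ContMDiff (𝓡 n) 𝓘(ℝ, ℝ) 1 θ) (h2 : HasCompactSupport θ) :=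
        integrable_mul_of_continuousOn (n := n) h1.continuous h2 isOpen_univ (Set.subset_univ _)
          (continuous_laplaceBeltrami hf).continuousOn
      simp only [Pi.add_apply, add_mul]
      rw [integral_add (hint h1 h2) (hint k1 k2), h3, k3, ← neg_add,
        ← integral_add (integrable_gradInner h1 h2 hf1) (integrable_gradInner k1 k2 hf1)]
      congr 2
      ext q
      exact (gradInner_add_left (h1.mdifferentiableAt one_ne_zero)
        (k1.mdifferentiableAt one_ne_zero)).symm
    · have h0 (q : M) : gradInner (n := n) 0 f q = 0 :=
        gradInner_eq_zero_of_notMem_tsupport (by simp [tsupport])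
      exact ⟨contMDiff_const, HasCompactSupport.zero, by simp [h0]⟩
    · intro i _
      have h1 : ContMDiff (𝓡 n) 𝓘(ℝ, ℝ) 1 (⇑(ρ i) * ψ) :=
        ((ρ i).contMDiff.of_le ENat.LEInfty.out).mul hψ
      have h2 : HasCompactSupport (⇑(ρ i) * ψ) := hc.mul_left
      have h3 : tsupport (⇑(ρ i) * ψ) ⊆ (chartAt (EuclideanSpace ℝ (Fin n)) i).source :=
        tsupport_mul_subset_left.trans (hρ i)
      refine ⟨h1, h2, ?_⟩
      rw [← integral_mul_chartLaplacian hf h1 h2 h3]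
      congr 1
      ext q
      by_cases hq : q ∈ tsupport (⇑(ρ i) * ψ)
      · rw [chartLaplacian_eq_laplaceBeltrami hf (h3 hq)]
      · rw [image_eq_zero_of_notMem_tsupport hq, zero_mul, zero_mul]
  rw [hsum] at hP
  exact hP.2.2

end Green

/-! ### The coefficients of the system and their quadratic form. -/

theorem continuous_partialH {m : ℕ} {H : Fin m → (Fin m → ℝ) → ℝ} (hH : ∀ i, ContDiff ℝ 1 (H i))
    (i j : Fin m) : Continuous (partialH H i j) :=
  ((hH i).continuous_fderiv one_ne_zero).clm_apply continuous_const

/-- For a matrix `A` with `A_{ij} z_i z_j > 0`, the quadratic form of `√(A_{ij} A_{ji})` is bounded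
by the diagonal form with coefficients `∑_j A_{ij} z_j / z_i`. -/
theorem sum_sqrt_mul_le {ι : Type*} [Fintype ι] {A : ι → ι → ℝ} {z w : ι → ℝ}
    (h : ∀ i j, 0 < A i j * z i * z j) :
    ∑ i, ∑ j, Real.sqrt (A i j * A j i) * w i * w j ≤
      ∑ i, ∑ j, A i j * (z j / z i) * w i ^ 2 := by
  have hz (i : ι) : z i ≠ 0 := by
    rintro h0
    simpa [h0] using h i i
  set B : ι → ι → ℝ := fun i j ↦ A i j * (z j / z i) with hB
  have hBpos (i j : ι) : 0 < B i j := by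
    have : B i j = A i j * z i * z j / z i ^ 2 := by
      simp only [hB]
      field_simp [hz i]
    rw [this]
    exact div_pos (h i j) (by have := hz i; positivity)
  have hAB (i j : ι) : A i j * A j i = B i j * B j i := by
    simp only [hB]
    field_simp [hz i, hz j]
  have key (i j : ι) : 2 * (Real.sqrt (A i j * A j i) * w i * w j) ≤
      B i j * w i ^ 2 + B j i * w j ^ 2 := by
    rw [hAB, Real.sqrt_mul (hBpos i j).le]
    have h1 := Real.sq_sqrt (hBpos i j).le
    have h2 := Real.sq_sqrt (hBpos j i).le
    -- Expanding `(√B_ij w_i - √B_ji w_j)² ≥ 0`; the signs of `w_i` and `w_j` play no role.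
    nlinarith [sq_nonneg (Real.sqrt (B i j) * w i - Real.sqrt (B j i) * w j)]
  have hsum := Finset.sum_le_sum fun i (_ : i ∈ Finset.univ) ↦
    Finset.sum_le_sum fun j (_ : j ∈ Finset.univ) ↦ key i j
  simp only [Finset.sum_add_distrib, ← Finset.mul_sum] at hsum
  -- Swapping indices makes the two sums on the right equal, which cancels the factor `2`.
  rw [Finset.sum_comm (f := fun i j ↦ B j i * w j ^ 2)] at hsum
  linarith

end RiemannianSystem

end

/-! ### The stability inequality. -/

theorem lemma2p1 {n m : ℕ} {M : Type*} [EMetricSpace M]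
    [ChartedSpace (EuclideanSpace ℝ (Fin n)) M] [IsManifold (𝓡 n) ∞ M]
    [SecondCountableTopology M] [ConnectedSpace M]
    [RiemannianBundle (fun x : M ↦ TangentSpace (𝓡 n) x)]
    [IsContMDiffRiemannianBundle (𝓡 n) ∞ (EuclideanSpace ℝ (Fin n))
      (fun x : M ↦ TangentSpace (𝓡 n) x)]
    [IsRiemannianManifold (𝓡 n) M] [CompleteSpace M]
    [MeasurableSpace M] [BorelSpace M]
    (H : Fin m → (Fin m → ℝ) → ℝ) (hH : ∀ i, ContDiff ℝ 1 (H i))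
    (u : Fin m → M → ℝ) (hu : RiemannianSystem.IsStableSolution n H u)
    (φ : Fin m → M → ℝ) (hφ : ∀ i, ContMDiff (𝓡 n) 𝓘(ℝ, ℝ) 1 (φ i))
    (hφc : ∀ i, HasCompactSupport (φ i)) :
    (∀ i j, Integrable
      (fun p ↦ Real.sqrt (RiemannianSystem.partialH H i j (fun k ↦ u k p) *
        RiemannianSystem.partialH H j i (fun k ↦ u k p)) * φ i p * φ j p)
      (RiemannianSystem.riemannianVolume n M)) ∧
    (∀ i, Integrable (fun p ↦ ‖RiemannianSystem.riemannianGradient (n := n) (φ i) p‖ ^ 2)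
      (RiemannianSystem.riemannianVolume n M)) ∧
    ∑ i, ∑ j, ∫ p, Real.sqrt (RiemannianSystem.partialH H i j (fun k ↦ u k p) *
        RiemannianSystem.partialH H j i (fun k ↦ u k p)) * φ i p * φ j p
        ∂(RiemannianSystem.riemannianVolume n M) ≤
      ∑ i, ∫ p, ‖RiemannianSystem.riemannianGradient (n := n) (φ i) p‖ ^ 2
        ∂(RiemannianSystem.riemannianVolume n M) := by
  simp only [← RiemannianSystem.gradInner_self]
  have := RiemannianSystem.isLocallyFiniteMeasure_riemannianVolume (n := n) (M := M)
  have hcH (i j : Fin m) :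
      Continuous fun p ↦ RiemannianSystem.partialH H i j (fun k ↦ u k p) :=
    (RiemannianSystem.continuous_partialH hH i j).comp
      (continuous_pi fun k ↦ (hu.contMDiff k).continuous)
  have hint1 (i j : Fin m) : Integrable
      (fun p ↦ Real.sqrt (RiemannianSystem.partialH H i j (fun k ↦ u k p) *
        RiemannianSystem.partialH H j i (fun k ↦ u k p)) * φ i p * φ j p)
      (RiemannianSystem.riemannianVolume n M) :=
    Continuous.integrable_of_hasCompactSupport
      ((((hcH i j).mul (hcH j i)).sqrt.mul (hφ i).continuous).mul (hφ j).continuous)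
      (hφc j).mul_left
  have hint2 (i : Fin m) := RiemannianSystem.integrable_gradInner (hφ i) (hφc i) (hφ i)
  refine ⟨hint1, hint2, ?_⟩
  obtain ⟨ζ, lam, hlam, hζ, -, hEq, hpos⟩ := hu.stable
  -- The diagonal case of the positivity condition contains `ζ_i²`.
  have hζ0 (i : Fin m) (p : M) : ζ i p ≠ 0 := by
    intro h0
    simpa [h0] using hpos i i p
  have hζ1 (i : Fin m) : ContMDiff (𝓡 n) 𝓘(ℝ, ℝ) 1 (ζ i) :=
    (hζ i).of_le (by norm_num)
  have hζ2 (i : Fin m) : ContMDiff (𝓡 n) 𝓘(ℝ, ℝ) 2 (ζ i) :=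
    (hζ i).of_le (by norm_num)
  set χ : Fin m → M → ℝ := fun i p ↦ φ i p / ζ i p with hχ
  have hχ1 (i : Fin m) : ContMDiff (𝓡 n) 𝓘(ℝ, ℝ) 1 (χ i) := (hφ i).div₀ (hζ1 i) (hζ0 i)
  have hχφ (i : Fin m) : χ i * ζ i = φ i := by
    ext p
    simp [hχ, hζ0 i p]
  -- The test function `χ_i φ_i = φ_i² / ζ_i`.
  have hψ1 (i : Fin m) : ContMDiff (𝓡 n) 𝓘(ℝ, ℝ) 1 (χ i * φ i) := (hχ1 i).mul (hφ i)
  have hψc (i : Fin m) : HasCompactSupport (χ i * φ i) := (hφc i).mul_left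
  have hint3 (i : Fin m) : Integrable
      (fun p ↦ (χ i * φ i) p * -RiemannianSystem.laplaceBeltrami (n := n) (ζ i) p)
      (RiemannianSystem.riemannianVolume n M) :=
    RiemannianSystem.integrable_mul_of_continuousOn (n := n)
    (hψ1 i).continuous (hψc i) isOpen_univ (Set.subset_univ _)
    (RiemannianSystem.continuous_laplaceBeltrami (hζ2 i)).neg.continuousOn
  have hle (i : Fin m) : ∫ p, (χ i * φ i) p * -RiemannianSystem.laplaceBeltrami (n := n) (ζ i) p
      ∂(RiemannianSystem.riemannianVolume n M) ≤
      ∫ p, RiemannianSystem.gradInner (n := n) (φ i) (φ i) p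
        ∂(RiemannianSystem.riemannianVolume n M) := by
    simp only [mul_neg]
    rw [integral_neg, RiemannianSystem.integral_mul_laplaceBeltrami (hζ2 i) (hψ1 i) (hψc i),
      neg_neg]
    refine integral_mono (RiemannianSystem.integrable_gradInner (hψ1 i) (hψc i) (hζ1 i))
      (hint2 i) fun p ↦ ?_
    have := RiemannianSystem.gradInner_mul_mul_le (n := n)
      ((hχ1 i).mdifferentiableAt (x := p) one_ne_zero) ((hζ1 i).mdifferentiableAt one_ne_zero)
    rwa [hχφ] at this
  refine le_trans ?_ (Finset.sum_le_sum fun i _ ↦ hle i)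
  -- The sums go under the integral because the remaining inequality holds pointwise only for the
  -- whole double sum, not for each `i`.
  rw [← integral_finsetSum _ fun i _ ↦ hint3 i]
  simp only [← integral_finsetSum _ fun j _ ↦ hint1 _ j]
  rw [← integral_finsetSum _ fun i _ ↦ integrable_finsetSum _ fun j _ ↦ hint1 i j]
  refine integral_mono (integrable_finsetSum _ fun i _ ↦
    integrable_finsetSum _ fun j _ ↦ hint1 i j) (integrable_finsetSum _ fun i _ ↦ hint3 i)
    fun p ↦ ?_
  refine (RiemannianSystem.sum_sqrt_mul_le (fun i j ↦ hpos i j p)).trans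
    (Finset.sum_le_sum fun i _ ↦ ?_)
  have h0 := hζ0 i p
  have h1 : (χ i * φ i) p * -RiemannianSystem.laplaceBeltrami (n := n) (ζ i) p =
      (∑ j, RiemannianSystem.partialH H i j (fun k ↦ u k p) * (ζ j p / ζ i p) * φ i p ^ 2) +
        lam * φ i p ^ 2 := by
    rw [hEq i p, mul_add, Finset.mul_sum]
    simp only [Pi.mul_apply, hχ]
    congr 1
    · exact Finset.sum_congr rfl fun j _ ↦ by ring
    · field_simp
  rw [h1]
  -- The term `λ φ_i²` has the favourable sign.
  exact le_add_of_nonneg_right (mul_nonneg hlam (sq_nonneg _))
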